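/- Let $q$ be an indeterminate. For integers $m,n\ge 0$ put $[n]_q=1+q+\cdots+q^{n-1}$, $[n]_q!=[1]_q[2]_q\cdots[n]_q$, and ${m\brack n}_q=\frac{[m]_q!}{[n]_q!\,[m-n]_q!}$ if $n\le m$, ${m\brack n}_q=0$ if $n>m$; ${m\brack n}_{q^2}$ denotes the same expression with $q$ replaced by $q^2$. Let $j\ge 1$ be an integer. For $n\ge 1$ and $r\ge 0$ with $r\le n$ or $2r\le n+j$, define the $q$-Ballot number and the terms $$B_j(n,q)=\frac{[j]_q}{[2n+j]_q}{2n+j\brack n}_q,\qquad T_r^{(j)}(n,q)=q^{r^2-r}{n\brack r}_{q^2}{2n+j-1-2r\brack n-1}_q\frac{[j]_q}{[n]_q}.$$ Then: 1. For every $n\ge 1$, $\displaystyle B_j(n,q)=\sum_{r=1}^n(-1)^{r-1}T_r^{(j)}(n,q)$ (as rational functions in $q$). 2. For all $n\ge 1$ and $r\ge 0$ with $n\ge 2r-j$, $T_r^{(j)}(n,q)$ is a polynomial in $q$ with integer coefficients. 3. For every $r\ge j$, $T_r^{(j)}(2r-j,-q)$ is a polynomial in $q$ all of whose coefficients are nonnegative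 integers. -/

import Mathlib

open Polynomial

noncomputable section

/-- The `q`-integer `[n]_q = 1 + q + ⋯ + q^(n-1)`. -/
def qInt {K : Type*} [Field K] (q : K) (n : ℕ) : K :=
  ∑ i ∈ Finset.range n, q ^ i

/-- The `q`-factorial `[n]_q! = [1]_q [2]_q ⋯ [n]_q`. -/
def qFact {K : Type*} [Field K] (q : K) (n : ℕ) : K :=
  ∏ i ∈ Finset.Icc 1 n, qInt q i

/-- The `q`-binomial coefficient `[m]_q! / ([n]_q! [m-n]_q!)`, which is `0` for `n > m`.
It is only used where `q` is not a root of unity, so that no denominator vanishes. -/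
def qBinom {K : Type*} [Field K] (q : K) (m n : ℕ) : K :=
  if n ≤ m then qFact q m / (qFact q n * qFact q (m - n)) else 0

/-- The `q`-Ballot number `B_j(n,q)`. -/
def qBallot {K : Type*} [Field K] (q : K) (j n : ℕ) : K :=
  qInt q j / qInt q (2 * n + j) * qBinom q (2 * n + j) n

/-- The term `T_r^{(j)}(n,q)`. The subtractions are exact in the cases of interest:
`j, n ≥ 1` with `r ≤ n` or `2 r ≤ n + j`. -/
def qBallotTerm {K : Type*} [Field K] (q : K) (j r n : ℕ) : K :=
  q ^ (r ^ 2 - r) * qBinom (q ^ 2) n r * qBinom q (2 * n + j - 1 - 2 * r) (n - 1) *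
    (qInt q j / qInt q n)

end

/-! Since T_0 = B_j, the identity says that the alternating sum of T_r over 0 ≤ r ≤ n vanishes. Up
to a constant factor, the second binomial in T_r is a polynomial of degree less than n in q^(-2r),
and the q²-binomial theorem kills such polynomials against (-1)^r q^(r²-r) [n r]_{q²}
(`sum_gaussBinom_mul_eval_eq_zero`).

For integrality, 1 - q^j is split into pieces that each absorb the denominator 1 - q^n
(`qBallotTerm_eq_integral`).

For positivity, the extremal term is a power of q times a difference of two q²-binomials
(`qBallotTerm_extremal`). Under q ↦ -q an odd j turns the difference into a sum. An even j needs
`gaussBinom_sub_mem`, where the difference is a coefficient of a product whose factors pair up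
around the middle one.

Binomials given by Pascal's rule exist over ℤ[q] and commute with ring maps, so these formulas
supply the polynomials required. -/

/-- The Gaussian binomial coefficient, as given by Pascal's rule over an arbitrary ring. -/
def gaussBinom {R : Type*} [CommRing R] (q : R) : ℕ → ℕ → R
  | _, 0 => 1
  | 0, _ + 1 => 0
  | m + 1, k + 1 => gaussBinom q m k + q ^ (k + 1) * gaussBinom q m (k + 1)

/-! ### Division-free Gaussian binomials and the q-binomial theorem -/

section CommRing

variable {R : Type*} [CommRing R] (q : R)

@[simp] lemma gaussBinom_zero_right (m : ℕ) : gaussBinom q m 0 = 1 := by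
  cases m <;> rfl

@[simp] lemma gaussBinom_zero_succ (k : ℕ) : gaussBinom q 0 (k + 1) = 0 := rfl

lemma gaussBinom_succ_succ (m k : ℕ) :
    gaussBinom q (m + 1) (k + 1) = gaussBinom q m k + q ^ (k + 1) * gaussBinom q m (k + 1) := rfl

lemma gaussBinom_eq_zero_of_lt {m k : ℕ} (h : m < k) : gaussBinom q m k = 0 := by
  induction m generalizing k with
  | zero =>
    obtain ⟨k, rfl⟩ := Nat.exists_eq_succ_of_ne_zero (by omega : k ≠ 0)
    rfl
  | succ m ih =>
    obtain ⟨k, rfl⟩ := Nat.exists_eq_succ_of_ne_zero (by omega : k ≠ 0)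
    rw [Nat.succ_eq_add_one, gaussBinom_succ_succ, ih (by omega), ih (by omega)]
    simp

lemma map_gaussBinom {S : Type*} [CommRing S] (f : R →+* S) (m k : ℕ) :
    f (gaussBinom q m k) = gaussBinom (f q) m k := by
  induction m generalizing k with
  | zero => cases k <;> simp
  | succ m ih => cases k <;> simp [gaussBinom_succ_succ, ih]

lemma gaussBinom_mem {S : Subsemiring R} (hq : q ∈ S) (m k : ℕ) : gaussBinom q m k ∈ S := by
  induction m generalizing k with
  | zero =>
    cases k with
    | zero => simp
    | succ k => simp
  | succ m ih =>
    cases k with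
    | zero => simp
    | succ k => exact S.add_mem (ih k) (S.mul_mem (S.pow_mem hq _) (ih _))

lemma prod_one_sub_pow_eq_zero {m k : ℕ} (h : m < k) :
    ∏ i ∈ Finset.range k, (1 - q ^ (m - i)) = 0 :=
  Finset.prod_eq_zero (Finset.mem_range.2 h) (by simp)

/-- The division-free product formula. It survives truncated subtraction: for m < k the right side
contains the factor 1 - q^0. -/
lemma gaussBinom_mul_prod (m k : ℕ) :
    gaussBinom q m k * ∏ i ∈ Finset.range k, (1 - q ^ (i + 1)) =
      ∏ i ∈ Finset.range k, (1 - q ^ (m - i)) := by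
  induction m generalizing k with
  | zero =>
    cases k with
    | zero => simp
    | succ k => rw [prod_one_sub_pow_eq_zero q k.succ_pos]; simp
  | succ m ih =>
    cases k with
    | zero => simp
    | succ k =>
      have h1 := ih k
      have h2 := ih (k + 1)
      rw [Finset.prod_range_succ _ k] at h2 ⊢
      rw [Finset.prod_range_succ _ k] at h2
      rw [Finset.prod_range_succ', gaussBinom_succ_succ]
      simp only [Nat.add_sub_add_right, Nat.sub_zero]
      rcases le_or_gt k m with hk | hk
      · have hp : q ^ (m + 1) = q ^ (k + 1) * q ^ (m - k) := by
          rw [← pow_add]; congr 1; omega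
        rw [hp]
        linear_combination (1 - q ^ (k + 1)) * h1 + q ^ (k + 1) * h2
      · rw [prod_one_sub_pow_eq_zero q hk] at h1 h2 ⊢
        linear_combination (1 - q ^ (k + 1)) * h1 + q ^ (k + 1) * h2

/-- The `q`-binomial theorem. -/
lemma prod_one_add_mul_pow (n : ℕ) (z : R) :
    ∏ i ∈ Finset.range n, (1 + z * q ^ i) =
      ∑ k ∈ Finset.range (n + 1), q ^ (k.choose 2) * gaussBinom q n k * z ^ k := by
  induction n generalizing z with
  | zero => simp
  | succ n ih =>
    have h : ∏ i ∈ Finset.range n, (1 + z * q ^ (i + 1)) =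
        ∏ i ∈ Finset.range n, (1 + z * q * q ^ i) :=
      Finset.prod_congr rfl fun i _ ↦ by ring
    rw [Finset.prod_range_succ', h, ih, Finset.sum_range_succ' _ (n + 1)]
    have hc : ∀ k : ℕ, (k + 1).choose 2 = k + k.choose 2 := fun k ↦ by
      rw [Nat.choose_succ_succ' k 1, Nat.choose_one_right]
    have e : ∑ k ∈ Finset.range (n + 1),
        q ^ ((k + 1).choose 2) * gaussBinom q (n + 1) (k + 1) * z ^ (k + 1) =
        z * ∑ k ∈ Finset.range (n + 1), q ^ (k.choose 2) * gaussBinom q n k * (z * q) ^ k +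
        ∑ k ∈ Finset.range (n + 1),
          q ^ ((k + 1).choose 2) * gaussBinom q n (k + 1) * (z * q) ^ (k + 1) := by
      rw [Finset.mul_sum, ← Finset.sum_add_distrib]
      refine Finset.sum_congr rfl fun k _ ↦ ?_
      rw [gaussBinom_succ_succ, hc]
      ring
    have e2 := Finset.sum_range_succ'
      (fun k ↦ q ^ (k.choose 2) * gaussBinom q n k * (z * q) ^ k) (n + 1)
    rw [Finset.sum_range_succ, gaussBinom_eq_zero_of_lt q (Nat.lt_succ_self n)] at e2
    rw [e]
    simp only [mul_zero, zero_mul, add_zero, Nat.choose_zero_succ, pow_zero,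
      gaussBinom_zero_right, mul_one] at e2 ⊢
    linear_combination e2

/-- An alternating `q`-binomial sum over values of a polynomial of degree less than `n`
at the powers of `q⁻¹` vanishes. -/
lemma sum_gaussBinom_mul_eval_eq_zero {x : R} (hx : x * q = 1) {n : ℕ} {f : R[X]}
    (hf : f.natDegree < n) :
    ∑ r ∈ Finset.range (n + 1),
      (-1) ^ r * (q ^ (r.choose 2) * gaussBinom q n r * f.eval (x ^ r)) = 0 := by
  have h : ∀ k ∈ Finset.range n, ∑ r ∈ Finset.range (n + 1),
      q ^ (r.choose 2) * gaussBinom q n r * (-x ^ k) ^ r = 0 := fun k hk ↦ by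
    rw [← prod_one_add_mul_pow]
    refine Finset.prod_eq_zero hk ?_
    rw [neg_mul, ← mul_pow, hx, one_pow, add_neg_cancel]
  calc
    _ = ∑ r ∈ Finset.range (n + 1), ∑ k ∈ Finset.range n,
        f.coeff k * (q ^ (r.choose 2) * gaussBinom q n r * (-x ^ k) ^ r) := by
      refine Finset.sum_congr rfl fun r _ ↦ ?_
      rw [eval_eq_sum_range' hf, Finset.mul_sum, Finset.mul_sum]
      refine Finset.sum_congr rfl fun k _ ↦ ?_
      rw [neg_pow (x ^ k), ← pow_mul, ← pow_mul, mul_comm r k]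
      ring
    _ = 0 := by
      rw [Finset.sum_comm]
      refine Finset.sum_eq_zero fun k hk ↦ ?_
      rw [← Finset.mul_sum, h k hk, mul_zero]

end CommRing

/-! ### The terms over a field where q is not a root of unity -/

section Field

variable {K : Type*} [Field K] {q : K}

lemma one_sub_pow_ne_zero (hq : ∀ n, 1 ≤ n → q ^ n ≠ 1) {n : ℕ} (hn : 1 ≤ n) :
    1 - q ^ n ≠ 0 := sub_ne_zero.2 (hq n hn).symm

lemma one_sub_ne_zero_of_pow (hq : ∀ n, 1 ≤ n → q ^ n ≠ 1) : 1 - q ≠ 0 := by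
  simpa using one_sub_pow_ne_zero hq le_rfl

lemma qInt_eq_div (hq : ∀ n, 1 ≤ n → q ^ n ≠ 1) (n : ℕ) :
    qInt q n = (1 - q ^ n) / (1 - q) := by
  rw [eq_div_iff (one_sub_ne_zero_of_pow hq), qInt, geom_sum_mul_neg]

lemma qInt_div_qInt (hq : ∀ n, 1 ≤ n → q ^ n ≠ 1) (j n : ℕ) :
    qInt q j / qInt q n = (1 - q ^ j) / (1 - q ^ n) := by
  rw [qInt_eq_div hq, qInt_eq_div hq, div_div_div_cancel_right₀ (one_sub_ne_zero_of_pow hq)]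

lemma qFact_succ (q : K) (n : ℕ) : qFact q (n + 1) = qFact q n * qInt q (n + 1) :=
  Finset.prod_Icc_succ_top (by omega) _

lemma qInt_ne_zero (hq : ∀ n, 1 ≤ n → q ^ n ≠ 1) {n : ℕ} (hn : 1 ≤ n) : qInt q n ≠ 0 := by
  rw [qInt_eq_div hq]
  exact div_ne_zero (one_sub_pow_ne_zero hq hn) (one_sub_ne_zero_of_pow hq)

lemma qFact_ne_zero (hq : ∀ n, 1 ≤ n → q ^ n ≠ 1) (n : ℕ) : qFact q n ≠ 0 :=
  Finset.prod_ne_zero_iff.2 fun _ hi ↦ qInt_ne_zero hq (Finset.mem_Icc.1 hi).1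

lemma prod_one_sub_pow_ne_zero (hq : ∀ n, 1 ≤ n → q ^ n ≠ 1) (k : ℕ) :
    ∏ i ∈ Finset.range k, (1 - q ^ (i + 1)) ≠ 0 :=
  Finset.prod_ne_zero_iff.2 fun _ _ ↦ one_sub_pow_ne_zero hq (by omega)

/-- Truncated subtraction is harmless here: both sides vanish for `m ≤ k`. -/
lemma gaussBinom_succ_right_mul (hq : ∀ n, 1 ≤ n → q ^ n ≠ 1) (m k : ℕ) :
    gaussBinom q m (k + 1) * (1 - q ^ (k + 1)) = gaussBinom q m k * (1 - q ^ (m - k)) := by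
  have h1 := gaussBinom_mul_prod q m (k + 1)
  have h2 := gaussBinom_mul_prod q m k
  rw [Finset.prod_range_succ, Finset.prod_range_succ, ← h2] at h1
  refine mul_right_cancel₀ (prod_one_sub_pow_ne_zero hq k) ?_
  linear_combination h1

lemma gaussBinom_succ_succ_mul (hq : ∀ n, 1 ≤ n → q ^ n ≠ 1) (m k : ℕ) :
    gaussBinom q (m + 1) (k + 1) * (1 - q ^ (k + 1)) = gaussBinom q m k * (1 - q ^ (m + 1)) := by
  have h1 := gaussBinom_mul_prod q (m + 1) (k + 1)
  have h2 := gaussBinom_mul_prod q m k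
  rw [Finset.prod_range_succ, Finset.prod_range_succ'] at h1
  simp only [Nat.add_sub_add_right, Nat.sub_zero] at h1
  rw [← h2] at h1
  refine mul_right_cancel₀ (prod_one_sub_pow_ne_zero hq k) ?_
  linear_combination h1

lemma qBinom_eq_gaussBinom (hq : ∀ n, 1 ≤ n → q ^ n ≠ 1) (m k : ℕ) :
    qBinom q m k = gaussBinom q m k := by
  rw [qBinom]
  split_ifs with h
  · rw [div_eq_iff (mul_ne_zero (qFact_ne_zero hq _) (qFact_ne_zero hq _))]
    induction k with
    | zero => simp [qFact]
    | succ k ih =>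
      rw [ih (by omega), qFact_succ, show m - k = m - (k + 1) + 1 by omega, qFact_succ,
        show m - (k + 1) + 1 = m - k by omega]
      have := gaussBinom_succ_right_mul hq m k
      rw [qInt_eq_div hq, qInt_eq_div hq]
      linear_combination -qFact q k * qFact q (m - (k + 1)) / (1 - q) * this
  · exact (gaussBinom_eq_zero_of_lt q (by omega)).symm

lemma gaussBinom_symm (hq : ∀ n, 1 ≤ n → q ^ n ≠ 1) {m k : ℕ} (h : k ≤ m) :
    gaussBinom q m (m - k) = gaussBinom q m k := by
  rw [← qBinom_eq_gaussBinom hq, ← qBinom_eq_gaussBinom hq, qBinom, qBinom, if_pos h,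
    if_pos (Nat.sub_le m k), Nat.sub_sub_self h, mul_comm]

lemma sq_pow_ne_one (hq : ∀ n, 1 ≤ n → q ^ n ≠ 1) (n : ℕ) (hn : 1 ≤ n) : (q ^ 2) ^ n ≠ 1 := by
  rw [← pow_mul]; exact hq _ (by omega)

lemma qBallotTerm_eq (hq : ∀ n, 1 ≤ n → q ^ n ≠ 1) (j r n : ℕ) :
    qBallotTerm q j r n = q ^ (r ^ 2 - r) * gaussBinom (q ^ 2) n r *
      gaussBinom q (2 * n + j - 1 - 2 * r) (n - 1) * ((1 - q ^ j) / (1 - q ^ n)) := by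
  rw [qBallotTerm, qBinom_eq_gaussBinom hq, qBinom_eq_gaussBinom (sq_pow_ne_one hq),
    qInt_div_qInt hq]

lemma qBallotTerm_zero (hq : ∀ n, 1 ≤ n → q ^ n ≠ 1) (j : ℕ) {n : ℕ} (hn : 1 ≤ n) :
    qBallotTerm q j 0 n = qBallot q j n := by
  obtain ⟨n, rfl⟩ := Nat.exists_eq_add_of_le' hn
  rw [qBallotTerm_eq hq, qBallot, qBinom_eq_gaussBinom hq, qInt_div_qInt hq,
    show 2 * (n + 1) + j - 1 - 2 * 0 = 2 * n + 1 + j by omega,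
    show 2 * (n + 1) + j = 2 * n + 1 + j + 1 by omega]
  have h := gaussBinom_succ_succ_mul hq (2 * n + 1 + j) n
  have h1 := one_sub_pow_ne_zero hq hn
  have h2 := one_sub_pow_ne_zero hq (show 1 ≤ 2 * n + 1 + j + 1 by omega)
  simp only [Nat.add_sub_cancel, gaussBinom_zero_right]
  simp only [ne_eq, OfNat.ofNat_ne_zero, not_false_eq_true, zero_pow, Nat.sub_zero, pow_zero,
    one_mul]
  rw [mul_div_assoc', div_mul_eq_mul_div, div_eq_div_iff h1 h2]
  linear_combination -(1 - q ^ j) * h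

/-- This exhibits the numerator of the second binomial as a polynomial in q^(-2r), to which the
vanishing sum applies. -/
lemma prod_one_sub_pow_sub_eq_eval (hq0 : q ≠ 0) {n j r : ℕ} (hj : 1 ≤ j) (hr : r ≤ n) :
    ∏ i ∈ Finset.range (n - 1), (1 - q ^ (2 * n + j - 1 - 2 * r - i)) =
      (∏ i ∈ Finset.range (n - 1), (1 - C (q ^ (2 * n + j - 1 - i)) * X)).eval
        (((q ^ 2)⁻¹) ^ r) := by
  have key : ∀ i, 2 * r + i ≤ 2 * n + j - 1 →
      q ^ (2 * n + j - 1 - i) * ((q ^ 2)⁻¹) ^ r = q ^ (2 * n + j - 1 - 2 * r - i) := by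
    intro i hi
    rw [show 2 * n + j - 1 - i = (2 * n + j - 1 - 2 * r - i) + 2 * r by omega, pow_add, pow_mul,
      mul_assoc, ← mul_pow, mul_inv_cancel₀ (pow_ne_zero 2 hq0), one_pow, mul_one]
  rw [eval_prod]
  simp only [eval_sub, eval_one, eval_mul, eval_C, eval_X]
  rcases le_or_gt (n - 1) (2 * n + j - 1 - 2 * r) with h | h
  · refine Finset.prod_congr rfl fun i hi ↦ ?_
    rw [key i (by have := Finset.mem_range.1 hi; omega)]
  -- Here the binomial is zero, and the factor i = 2n + j - 1 - 2r vanishes on the polynomial side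
  -- too.
  · rw [prod_one_sub_pow_eq_zero q h]
    refine (Finset.prod_eq_zero (Finset.mem_range.2 h) ?_).symm
    rw [key _ (by omega)]
    simp

lemma natDegree_prod_one_sub_C_mul_X_le {R : Type*} [CommRing R] (a : ℕ → R) (n : ℕ) :
    (∏ i ∈ Finset.range n, (1 - C (a i) * X)).natDegree ≤ n := by
  refine (natDegree_prod_le _ _).trans ?_
  refine (Finset.sum_le_card_nsmul _ _ 1 fun i _ ↦ ?_).trans (by simp)
  compute_degree

lemma two_mul_choose_two (r : ℕ) : 2 * r.choose 2 = r ^ 2 - r := by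
  rw [Nat.choose_two_right, Nat.mul_div_cancel' (Nat.even_mul_pred_self r).two_dvd,
    Nat.mul_sub, mul_one, sq]

lemma sum_qBallotTerm_eq_zero (hq : ∀ n, 1 ≤ n → q ^ n ≠ 1) (hq0 : q ≠ 0) {j n : ℕ}
    (hj : 1 ≤ j) (hn : 1 ≤ n) :
    ∑ r ∈ Finset.range (n + 1), (-1) ^ r * qBallotTerm q j r n = 0 := by
  set f : K[X] := ∏ i ∈ Finset.range (n - 1), (1 - C (q ^ (2 * n + j - 1 - i)) * X) with hf
  have hdeg : f.natDegree < n :=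
    (natDegree_prod_one_sub_C_mul_X_le (fun i ↦ q ^ (2 * n + j - 1 - i)) (n - 1)).trans_lt
      (by omega)
  have h := sum_gaussBinom_mul_eval_eq_zero (q ^ 2)
    (inv_mul_cancel₀ (pow_ne_zero 2 hq0)) hdeg
  set D := ∏ i ∈ Finset.range (n - 1), (1 - q ^ (i + 1)) with hD
  have hD0 : D ≠ 0 := prod_one_sub_pow_ne_zero hq (n - 1)
  have e : ∀ r ∈ Finset.range (n + 1), (-1) ^ r * qBallotTerm q j r n =
      (-1) ^ r * ((q ^ 2) ^ (r.choose 2) * gaussBinom (q ^ 2) n r * f.eval (((q ^ 2)⁻¹) ^ r)) *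
        ((1 - q ^ j) / (1 - q ^ n) / D) := by
    intro r hr
    rw [qBallotTerm_eq hq, hf,
      ← prod_one_sub_pow_sub_eq_eval hq0 hj (by have := Finset.mem_range.1 hr; omega),
      ← gaussBinom_mul_prod, ← hD, ← pow_mul, two_mul_choose_two]
    field_simp
  rw [Finset.sum_congr rfl e, ← Finset.sum_mul, h, zero_mul]

lemma qBallot_eq_sum (hq : ∀ n, 1 ≤ n → q ^ n ≠ 1) (hq0 : q ≠ 0) {j n : ℕ}
    (hj : 1 ≤ j) (hn : 1 ≤ n) :
    qBallot q j n = ∑ r ∈ Finset.Icc 1 n, (-1) ^ (r - 1) * qBallotTerm q j r n := by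
  have h := sum_qBallotTerm_eq_zero hq hq0 hj hn
  rw [Finset.sum_range_succ', pow_zero, one_mul, qBallotTerm_zero hq j hn] at h
  rw [← Finset.Ico_add_one_right_eq_Icc, Finset.sum_Ico_eq_sum_range, Nat.add_sub_cancel,
    eq_neg_of_add_eq_zero_right h, ← Finset.sum_neg_distrib]
  refine Finset.sum_congr rfl fun r _ ↦ ?_
  rw [Nat.add_sub_cancel_left, add_comm 1 r]
  ring

/-- The term with its denominator cleared. -/
lemma qBallotTerm_eq_integral (hq : ∀ n, 1 ≤ n → q ^ n ≠ 1) {j r n : ℕ} (hn : 1 ≤ n)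
    (h : 2 * r ≤ n + j) :
    qBallotTerm q j r n = q ^ (r ^ 2 - r) *
      (q ^ (n + j - 2 * r) * (1 + q ^ n) *
          (if r = 0 then 0 else gaussBinom (q ^ 2) (n - 1) (r - 1)) *
          gaussBinom q (2 * n + j - 1 - 2 * r) (n - 1) +
        gaussBinom (q ^ 2) n r * gaussBinom q (2 * n + j - 1 - 2 * r) n -
        gaussBinom (q ^ 2) n r * gaussBinom q (2 * n + j - 1 - 2 * r) (n - 1) *
          (1 + (q ^ j - 1))) := by
  obtain ⟨n, rfl⟩ := Nat.exists_eq_add_of_le' hn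
  obtain ⟨s, hs⟩ := Nat.exists_eq_add_of_le h
  have hB := gaussBinom_succ_right_mul hq (2 * (n + 1) + j - 1 - 2 * r) n
  rw [show 2 * (n + 1) + j - 1 - 2 * r - n = s by omega] at hB
  have hA : gaussBinom (q ^ 2) (n + 1) r * (1 - q ^ (2 * r)) =
      (if r = 0 then 0 else gaussBinom (q ^ 2) n (r - 1)) * (1 - q ^ (2 * (n + 1))) := by
    cases r with
    | zero => simp
    | succ r =>
      have := gaussBinom_succ_succ_mul (sq_pow_ne_one hq) n r
      simpa [← pow_mul] using this
  rw [qBallotTerm_eq hq, mul_assoc, mul_assoc]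
  congr 1
  have h0 := one_sub_pow_ne_zero hq hn
  simp only [Nat.add_sub_cancel]
  rw [mul_div_assoc', mul_div_assoc', div_eq_iff h0, show n + 1 + j - 2 * r = s by omega]
  set A := gaussBinom (q ^ 2) (n + 1) r
  set A' := if r = 0 then 0 else gaussBinom (q ^ 2) n (r - 1)
  set B := gaussBinom q (2 * (n + 1) + j - 1 - 2 * r) n
  have e : q ^ (n + 1) * q ^ j = q ^ s * q ^ (2 * r) := by
    rw [← pow_add, ← pow_add, hs, add_comm]
  have e2 : q ^ (2 * (n + 1)) = q ^ (n + 1) * q ^ (n + 1) := by ring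
  rw [e2] at hA
  -- With s = n + j - 2r (n the original index), 1 - q^j = (1 - q^s) + q^s (1 - q^(2r)) - q^j (1 -
  -- q^n). The first piece is absorbed by B, the second by A, and the third is already a multiple of
  -- 1 - q^n.
  linear_combination -A * hB + q ^ s * B * hA - A * B * e

/-- The extremal term as a difference of two Gaussian binomial coefficients. -/
lemma qBallotTerm_extremal (hq : ∀ n, 1 ≤ n → q ^ n ≠ 1) {j r : ℕ} (hj : 1 ≤ j) (h : j ≤ r) :
    qBallotTerm q j r (2 * r - j) = q ^ (r ^ 2 - r) *
      (gaussBinom (q ^ 2) (2 * r - j - 1) (r - j) -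
        q ^ j * gaussBinom (q ^ 2) (2 * r - j - 1) r) := by
  obtain ⟨m, rfl⟩ := Nat.exists_eq_add_of_le' h
  obtain ⟨r, hr⟩ : ∃ r, m + j = r + 1 := ⟨m + j - 1, by omega⟩
  have hn : 2 * (m + j) - j = r + m + 1 := by omega
  rw [qBallotTerm_eq hq, hn, Nat.add_sub_cancel, Nat.add_sub_cancel,
    show 2 * (r + m + 1) + j - 1 - 2 * (m + j) = r + m by omega, hr,
    ← gaussBinom_symm (sq_pow_ne_one hq) (show m ≤ r + m by omega), Nat.add_sub_cancel]
  have hG : gaussBinom q (r + m) (r + m) = 1 := by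
    rw [← gaussBinom_symm hq le_rfl, Nat.sub_self, gaussBinom_zero_right]
  have hp := sq_pow_ne_one hq
  have h1 := gaussBinom_succ_succ_mul hp (r + m) r
  have h2 := gaussBinom_succ_right_mul hp (r + m) r
  rw [Nat.add_sub_cancel_left] at h2
  have n1 := one_sub_pow_ne_zero hq (show 1 ≤ r + m + 1 by omega)
  have n2 := one_sub_pow_ne_zero hp (show 1 ≤ r + 1 by omega)
  rw [hG, mul_one, mul_assoc]
  congr 1
  rw [mul_div_assoc', div_eq_iff n1]
  refine mul_right_cancel₀ n2 ?_
  have e : q ^ j * q ^ m = q ^ (r + 1) := by rw [← pow_add, ← hr, add_comm]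
  have e2 : q ^ (r + m + 1) = q ^ (r + 1) * q ^ m := by ring
  have p1 : (q ^ 2) ^ (r + 1) = q ^ (r + 1) * q ^ (r + 1) := by ring
  have p2 : (q ^ 2) ^ (r + m + 1) = (q ^ (r + 1) * q ^ m) ^ 2 := by rw [← e2]; ring
  have p3 : (q ^ 2) ^ m = (q ^ m) ^ 2 := by ring
  rw [p1, p2] at h1
  rw [p1, p3] at h2
  rw [p1, e2]
  rw [← e] at h1 h2 ⊢
  -- With original r = j + m and n = j + 2m, this rests on (1 - q^(2r)) - q^j (1 - q^(2m)) = (1 -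
  -- q^j)(1 + q^n).
  linear_combination (1 - q ^ j) * h1 + q ^ j * (1 - q ^ j * q ^ m * q ^ m) * h2

end Field

/-! ### Positivity, with a subsemiring S playing the role of the nonnegative elements -/

section Positivity

variable {R : Type*} [CommRing R]

/-- The coefficient is (C(l,a) - C(l,a-1)) e^a, and binomial coefficients increase up to the middle.
-/
lemma coeff_one_sub_mul_one_add_pow_mem {S : Subsemiring R} {e : R} (he : e ∈ S) {l a : ℕ}
    (h : 2 * a ≤ l + 1) : ((1 - C e * X) * (1 + C e * X) ^ l).coeff a ∈ S := by
  have hc : ∀ b, ((1 + C e * X) ^ l).coeff b = (l.choose b : R) * e ^ b := fun b ↦ by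
    rw [← coeff_one_add_X_pow, ← comp_C_mul_X_coeff]
    simp
  rw [sub_mul, one_mul, coeff_sub, mul_assoc, coeff_C_mul, hc]
  cases a with
  | zero => simp
  | succ a =>
    rw [coeff_X_mul, hc]
    have hle : l.choose a ≤ l.choose (a + 1) := by
      refine Nat.le_of_mul_le_mul_right ?_ a.succ_pos
      rw [Nat.succ_eq_add_one, Nat.choose_succ_right_eq]
      exact Nat.mul_le_mul_left _ (by omega)
    have : (l.choose (a + 1) : R) * e ^ (a + 1) - e * ((l.choose a : R) * e ^ a) =
        ((l.choose (a + 1) - l.choose a : ℕ) : R) * e ^ (a + 1) := by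
      rw [Nat.cast_sub hle]; ring
    rw [this]
    exact S.mul_mem (natCast_mem S _) (S.pow_mem he _)

lemma coeff_one_sub_sq_mul_one_add_sq_pow_mem {S : Subsemiring R} {e : R} (he : e ∈ S) {l a : ℕ}
    (h : a ≤ l + 1) : ((1 - C e * X ^ 2) * (1 + C e * X ^ 2) ^ l).coeff a ∈ S := by
  have : (1 - C e * X ^ 2) * (1 + C e * X ^ 2) ^ l =
      expand R 2 ((1 - C e * X) * (1 + C e * X) ^ l) := by simp
  rw [this, coeff_expand two_pos]
  split_ifs with h2
  · exact coeff_one_sub_mul_one_add_pow_mem he (by omega)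
  · exact S.zero_mem

lemma coeff_one_sub_sq_mul_prod_mem {S : Subsemiring R} {e : R} (he : e ∈ S) {y : ℕ → R}
    (hy : ∀ i, y i ∈ S) {k m : ℕ} (h : m ≤ k + 1) :
    ((1 - C e * X ^ 2) *
      ∏ i ∈ Finset.range k, (C (y i) * X + (1 + C e * X ^ 2))).coeff m ∈ S := by
  -- Expand over the set t of indices contributing `C (y i) * X`; this lowers both the target degree
  -- and the remaining exponent by |t|, preserving the degree bound.
  rw [Finset.prod_add, Finset.mul_sum, finsetSum_coeff]
  refine S.sum_mem fun t ht ↦ ?_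
  have ht' := Finset.mem_powerset.1 ht
  have hcard : t.card ≤ k := by simpa using Finset.card_le_card ht'
  have : (1 - C e * X ^ 2) * ((∏ i ∈ t, C (y i) * X) *
      ∏ _i ∈ Finset.range k \ t, (1 + C e * X ^ 2)) =
      C (∏ i ∈ t, y i) * (X ^ t.card *
        ((1 - C e * X ^ 2) * (1 + C e * X ^ 2) ^ (k - t.card))) := by
    rw [Finset.prod_const, Finset.card_sdiff_of_subset ht', Finset.card_range,
      Finset.prod_mul_distrib, Finset.prod_const, map_prod]
    ring
  rw [this, coeff_C_mul, coeff_X_pow_mul']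
  refine S.mul_mem (S.prod_mem fun i _ ↦ hy i) ?_
  split_ifs
  · exact coeff_one_sub_sq_mul_one_add_sq_pow_mem he (by omega)
  · exact S.zero_mem

lemma prod_range_two_mul_add_one {M : Type*} [CommMonoid M] (f : ℕ → M) (k : ℕ) :
    ∏ i ∈ Finset.range (2 * k + 1), f i =
      f k * ∏ i ∈ Finset.range k, (f (k - 1 - i) * f (k + 1 + i)) := by
  rw [show 2 * k + 1 = k + (k + 1) by ring, Finset.prod_range_add, Finset.prod_range_succ',
    Finset.prod_mul_distrib, Finset.prod_range_reflect, add_zero, mul_comm, mul_assoc]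
  simp only [add_assoc, add_comm 1]
  rw [mul_comm]
  simp only [mul_assoc]

/-- Multiplying ∏ (1 + p^(i+1) X), 0 ≤ i ≤ 2k, by 1 - p^(k+1) X completes the middle factor to 1 -
eX² with e = p^(2k+2). The other factors pair symmetrically into 1 + yX + eX² with the same e. The
q-binomial theorem reads the coefficient of X^(m+1) as this difference. -/
lemma gaussBinom_sub_mem {S : Subsemiring R} {p : R} (hp : p ∈ S) {N m : ℕ} (hN : m + 1 ≤ N) :
    p ^ ((m + 2).choose 2) * (gaussBinom p (2 * N - 1) (m + 1) -
      p ^ (N - (m + 1)) * gaussBinom p (2 * N - 1) m) ∈ S := by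
  obtain ⟨k, rfl⟩ := Nat.exists_eq_add_of_le' (show 1 ≤ N by omega)
  have hn : 2 * (k + 1) - 1 = 2 * k + 1 := by omega
  rw [hn]
  have hprod : (1 - C (p ^ (k + 1)) * X) *
      ∏ i ∈ Finset.range (2 * k + 1), (1 + C p * X * C p ^ i) =
      (1 - C (p ^ (2 * (k + 1))) * X ^ 2) * ∏ i ∈ Finset.range k,
        (C (p ^ (k - i) + p ^ (k + 2 + i)) * X + (1 + C (p ^ (2 * (k + 1))) * X ^ 2)) := by
    rw [prod_range_two_mul_add_one, ← mul_assoc]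
    congr 1
    · simp only [map_pow]; ring
    · refine Finset.prod_congr rfl fun i hi ↦ ?_
      obtain ⟨s, rfl⟩ : ∃ s, k = s + 1 + i :=
        ⟨k - 1 - i, by have := Finset.mem_range.1 hi; omega⟩
      rw [show s + 1 + i - 1 - i = s by omega, show s + 1 + i - i = s + 1 by omega]
      simp only [map_pow, map_add]
      ring
  have hmem := coeff_one_sub_sq_mul_prod_mem (S := S) (S.pow_mem hp (2 * (k + 1)))
    (y := fun i ↦ p ^ (k - i) + p ^ (k + 2 + i))
    (fun i ↦ S.add_mem (S.pow_mem hp _) (S.pow_mem hp _)) hN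
  rw [← hprod, prod_one_add_mul_pow] at hmem
  have hcoeff : ∀ a, a ≤ 2 * k + 1 → (∑ i ∈ Finset.range (2 * k + 1 + 1),
      C p ^ (i.choose 2) * gaussBinom (C p) (2 * k + 1) i * (C p * X) ^ i).coeff a =
      p ^ (a.choose 2 + a) * gaussBinom p (2 * k + 1) a := by
    intro a ha
    have : ∀ i, C p ^ (i.choose 2) * gaussBinom (C p) (2 * k + 1) i * (C p * X) ^ i =
        C (p ^ (i.choose 2 + i) * gaussBinom p (2 * k + 1) i) * X ^ i := fun i ↦ by
      rw [← map_gaussBinom]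
      simp only [map_pow, map_mul]
      ring
    simp only [this, finsetSum_coeff, coeff_C_mul_X_pow]
    rw [Finset.sum_ite_eq, if_pos (Finset.mem_range.2 (by omega))]
  rw [sub_mul, one_mul, coeff_sub, mul_assoc, coeff_C_mul, coeff_X_mul,
    hcoeff _ (by omega), hcoeff _ (by omega)] at hmem
  convert hmem using 1
  have hc : ∀ a : ℕ, (a + 1).choose 2 = a.choose 2 + a := fun a ↦ by
    rw [Nat.choose_succ_succ' a 1, Nat.choose_one_right, add_comm]
  rw [hc (m + 1), mul_sub, ← mul_assoc, ← mul_assoc, ← pow_add, ← pow_add]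
  congr 3
  have := hc m
  omega

end Positivity

/-! ### Nonnegativity in ℤ[q] and transfer to rational functions -/

lemma mem_lifts_natCast_iff {P : ℤ[X]} :
    P ∈ lifts (Nat.castRingHom ℤ) ↔ ∀ k, 0 ≤ P.coeff k := by
  rw [lifts_iff_coeff_lifts]
  refine forall_congr' fun k ↦ ⟨?_, fun h ↦ ⟨(P.coeff k).toNat, by simpa using h⟩⟩
  rintro ⟨a, ha⟩
  rw [← ha]
  simp

lemma mem_lifts_of_X_pow_mul_mem {P : ℤ[X]} (a : ℕ)
    (h : X ^ a * P ∈ lifts (Nat.castRingHom ℤ)) : P ∈ lifts (Nat.castRingHom ℤ) := by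
  rw [mem_lifts_natCast_iff] at h ⊢
  intro k
  simpa using h (k + a)

lemma ratFunc_X_pow_ne_one (n : ℕ) (hn : 1 ≤ n) : (RatFunc.X : RatFunc ℤ) ^ n ≠ 1 := by
  rw [← RatFunc.algebraMap_X, ← map_pow, ← map_one (algebraMap ℤ[X] (RatFunc ℤ))]
  intro h
  have := congrArg natDegree (RatFunc.algebraMap_injective ℤ h)
  simp at this
  omega

lemma ratFunc_X_ne_zero : (RatFunc.X : RatFunc ℤ) ≠ 0 := by
  rw [← RatFunc.algebraMap_X, ← map_zero (algebraMap ℤ[X] (RatFunc ℤ))]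
  exact fun h ↦ X_ne_zero (RatFunc.algebraMap_injective ℤ h)

lemma neg_ratFunc_X_pow_ne_one (n : ℕ) (hn : 1 ≤ n) : (-RatFunc.X : RatFunc ℤ) ^ n ≠ 1 := by
  intro h
  refine ratFunc_X_pow_ne_one (n * 2) (by omega) ?_
  rw [← (even_two.mul_left n).neg_pow, pow_mul, h, one_pow]

lemma gaussBinom_X_sq_symm {m k : ℕ} (h : k ≤ m) :
    gaussBinom ((X : ℤ[X]) ^ 2) m (m - k) = gaussBinom (X ^ 2) m k := by
  apply RatFunc.algebraMap_injective ℤ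
  rw [map_gaussBinom, map_gaussBinom, map_pow, RatFunc.algebraMap_X]
  exact gaussBinom_symm (sq_pow_ne_one ratFunc_X_pow_ne_one) h

lemma extremal_mem_lifts {j r : ℕ} (hj : 1 ≤ j) (h : j ≤ r) :
    gaussBinom ((X : ℤ[X]) ^ 2) (2 * r - j - 1) (r - j) -
      (-X) ^ j * gaussBinom (X ^ 2) (2 * r - j - 1) r ∈ lifts (Nat.castRingHom ℤ) := by
  have hX := X_mem_lifts (Nat.castRingHom ℤ)
  have hX2 := pow_mem hX 2
  rcases Nat.even_or_odd j with he | ho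
  · obtain ⟨i, rfl⟩ := he
    rw [(Even.add_self i).neg_pow]
    obtain ⟨m, rfl⟩ := Nat.exists_eq_add_of_le' h
    rw [Nat.add_sub_cancel]
    cases m with
    | zero =>
      -- For r = j the subtracted binomial is [j-1, j] = 0.
      rw [gaussBinom_eq_zero_of_lt _ (by omega : 2 * (0 + (i + i)) - (i + i) - 1 < 0 + (i + i))]
      simp
    | succ m =>
      have hsymm : gaussBinom ((X : ℤ[X]) ^ 2) (2 * (m + 1 + i) - 1) (m + 1 + (i + i)) =
          gaussBinom ((X : ℤ[X]) ^ 2) (2 * (m + 1 + i) - 1) m := by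
        rw [← gaussBinom_X_sq_symm (by omega)]
        congr 1
        omega
      have hmem := gaussBinom_sub_mem hX2 (show m + 1 ≤ m + 1 + i by omega)
      rw [show 2 * (m + 1 + (i + i)) - (i + i) - 1 = 2 * (m + 1 + i) - 1 by omega, hsymm]
      rw [← pow_mul, ← pow_mul, show 2 * (m + 1 + i - (m + 1)) = i + i by omega] at hmem
      exact mem_lifts_of_X_pow_mul_mem _ hmem
  · rw [ho.neg_pow, neg_mul, sub_neg_eq_add]
    exact add_mem (gaussBinom_mem _ hX2 _ _) (mul_mem (pow_mem hX _) (gaussBinom_mem _ hX2 _ _))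

section Realization

variable {K : Type*} [Field K] {q : K} {φ : ℤ[X] →+* K}

lemma exists_map_eq_qBallotTerm (hq : ∀ n, 1 ≤ n → q ^ n ≠ 1) (hφ : φ X = q) {j r n : ℕ}
    (hn : 1 ≤ n) (h : 2 * r ≤ n + j) : ∃ P : ℤ[X], φ P = qBallotTerm q j r n := by
  refine ⟨X ^ (r ^ 2 - r) *
    (X ^ (n + j - 2 * r) * (1 + X ^ n) *
        (if r = 0 then 0 else gaussBinom (X ^ 2) (n - 1) (r - 1)) *
        gaussBinom X (2 * n + j - 1 - 2 * r) (n - 1) +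
      gaussBinom (X ^ 2) n r * gaussBinom X (2 * n + j - 1 - 2 * r) n -
      gaussBinom (X ^ 2) n r * gaussBinom X (2 * n + j - 1 - 2 * r) (n - 1) *
        (1 + (X ^ j - 1))), ?_⟩
  rw [qBallotTerm_eq_integral hq hn h]
  split_ifs <;>
    simp only [map_mul, map_add, map_sub, map_pow, map_one, map_zero, map_gaussBinom, hφ]

lemma exists_nonneg_map_eq_qBallotTerm (hq : ∀ n, 1 ≤ n → (-q) ^ n ≠ 1) (hφ : φ X = q)
    {j r : ℕ} (hj : 1 ≤ j) (h : j ≤ r) :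
    ∃ P : ℤ[X], φ P = qBallotTerm (-q) j r (2 * r - j) ∧ ∀ k, 0 ≤ P.coeff k := by
  refine ⟨X ^ (r ^ 2 - r) * (gaussBinom (X ^ 2) (2 * r - j - 1) (r - j) -
    (-X) ^ j * gaussBinom (X ^ 2) (2 * r - j - 1) r), ?_, mem_lifts_natCast_iff.1
      (mul_mem (pow_mem (X_mem_lifts _) _) (extremal_mem_lifts hj h))⟩
  -- An even exponent keeps the prefactor free of sign under q ↦ -q.
  have hev : Even (r ^ 2 - r) := by
    rw [← two_mul_choose_two]
    exact even_two_mul _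
  rw [qBallotTerm_extremal hq hj h, hev.neg_pow, neg_sq]
  simp only [map_mul, map_sub, map_pow, map_neg, map_gaussBinom, hφ]

end Realization

/-- `RatFunc ℤ` is the field of fractions of `ℤ[q]`, with `RatFunc.X` the indeterminate `q`. -/
theorem mainTheorem2 (j : ℕ) (hj : 1 ≤ j) :
    (∀ n : ℕ, 1 ≤ n →
      qBallot (RatFunc.X : RatFunc ℤ) j n =
        ∑ r ∈ Finset.Icc 1 n, (-1) ^ (r - 1) * qBallotTerm (RatFunc.X : RatFunc ℤ) j r n) ∧
    (∀ n r : ℕ, 1 ≤ n → 2 * r ≤ n + j →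
      ∃ P : ℤ[X], algebraMap ℤ[X] (RatFunc ℤ) P = qBallotTerm (RatFunc.X : RatFunc ℤ) j r n) ∧
    (∀ r : ℕ, j ≤ r →
      ∃ P : ℤ[X],
        algebraMap ℤ[X] (RatFunc ℤ) P = qBallotTerm (-RatFunc.X : RatFunc ℤ) j r (2 * r - j) ∧
        ∀ k : ℕ, 0 ≤ P.coeff k) := by
  exact ⟨fun n hn ↦ qBallot_eq_sum ratFunc_X_pow_ne_one ratFunc_X_ne_zero hj hn,
    fun n r hn h ↦ exists_map_eq_qBallotTerm ratFunc_X_pow_ne_one RatFunc.algebraMap_X hn h,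
    fun r h ↦ exists_nonneg_map_eq_qBallotTerm neg_ratFunc_X_pow_ne_one RatFunc.algebraMap_X hj h⟩
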